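/- Let $\mathcal C=(\mathcal C,\mathbb E,\mathfrak s)$ be an extriangulated category (in the sense of Nakaoka and Palu) with enough projectives and enough injectives. "Subcategory" means full additive subcategory closed under isomorphisms and direct summands. A cotorsion pair on $\mathcal C$ is a pair $(\mathcal U,\mathcal V)$ of subcategories with $\mathbb E(\mathcal U,\mathcal V)=0$ such that every $C\in\mathcal C$ admits $\mathbb E$-triangles $V_C\to U_C\to C\dashrightarrow$ and $C\to V^C\to U^C\dashrightarrow$ with $U_C,U^C\in\mathcal U$ and $V_C,V^C\in\mathcal V$. For a subcategory $\mathcal V$ let $\Sigma\mathcal V$ be the class of all objects $Z$ admitting an $\mathbb E$-triangle $V\to I\to Z\dashrightarrow$ with $V\in\mathcal V$ and $I$ injective. For subcategories $\mathcal W\subseteq\mathcal D$ of $\mathcal C$ let $\mathcal D/\mathcal W$ be the additive category with the objects of $\mathcal D$, whose morphisms are those of $\mathcal C$ modulo the ones that factor through an object of $\mathcal W$. A recollement of additive categories consists of additive categories $\mathcal A',\mathcal A,\mathcal A''$, additive functors $F:\mathcal A'\to\mathcal A$ and $G:\mathcal A\to\mathcal A''$, adjunctions $F_\lambda\dashv F\dashv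 F_\rho$ and $G_\lambda\dashv G\dashv G_\rho$ with $F$, $G_\lambda$, $G_\rho$ fully faithful, such that for every $A\in\mathcal A$ one has $G(A)\cong 0$ if and only if $A\cong F(A')$ for some $A'\in\mathcal A'$. **Theorem.** Let $(\mathcal S,\mathcal T)$, $(\mathcal U,\mathcal V)$ and $(\mathcal X,\mathcal Y)$ be cotorsion pairs on $\mathcal C$ with $\mathcal W=\mathcal S\cap\mathcal T=\mathcal U\cap\mathcal V=\mathcal X\cap\mathcal Y$. Assume $\mathcal X\cap\mathcal T=\mathcal V$, $\mathcal Y\subseteq\mathcal T$, $\Sigma\mathcal V\subseteq\mathcal V$ and $\Sigma\mathcal Y\subseteq\mathcal Y$. Let $F:\mathcal V/\mathcal W\to\mathcal T/\mathcal W$ be the functor induced by the inclusion $\mathcal V\subseteq\mathcal T$. Then there are functors $F_\lambda,F_\rho:\mathcal T/\mathcal W\to\mathcal V/\mathcal W$ such that: 1. there are $G:\mathcal T/\mathcal W\to(\mathcal T\cap\mathcal U)/\mathcal W$ and $G_\rho:(\mathcal T\cap\mathcal U)/\mathcal W\to\mathcal T/\mathcal W$ which, together with $F,F_\lambda,F_\rho$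 and the functor $G_\lambda:(\mathcal T\cap\mathcal U)/\mathcal W\to\mathcal T/\mathcal W$ induced by the inclusion, form a recollement of additive categories $$\mathcal V/\mathcal W\xrightarrow{\;F\;}\mathcal T/\mathcal W\xrightarrow{\;G\;}(\mathcal T\cap\mathcal U)/\mathcal W;$$ 2. there are $G':\mathcal T/\mathcal W\to\mathcal Y/\mathcal W$ and $G'_\lambda:\mathcal Y/\mathcal W\to\mathcal T/\mathcal W$ which, together with the same $F,F_\lambda,F_\rho$ and the functor $G'_\rho:\mathcal Y/\mathcal W\to\mathcal T/\mathcal W$ induced by the inclusion, form a recollement of additive categories $$\mathcal V/\mathcal W\xrightarrow{\;F\;}\mathcal T/\mathcal W\xrightarrow{\;G'\;}\mathcal Y/\mathcal W.$$ In particular $F$, $G_\lambda$, $G_\rho$, $G'_\lambda$ and $G'_\rho$ are fully faithful. -/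

import Mathlib

open CategoryTheory CategoryTheory.Limits Opposite

universe w v u

namespace ExtriCat

/-! ## Extriangulated categories

An additive category is a preadditive category with a zero object and binary biproducts
(equivalently, with finite biproducts). -/

section Bifunctor

variable {C : Type u} [Category.{v} C] (E : Cᵒᵖ ⥤ C ⥤ AddCommGrpCat.{w})

/-- The group `𝔼(Z, A)` of extensions. -/
abbrev EExt (Z A : C) : Type w := ((E.obj (op Z)).obj A : AddCommGrpCat.{w})

/-- Push-out of extensions: `a_* δ ∈ 𝔼(Z, A')` for `a : A ⟶ A'` and `δ ∈ 𝔼(Z, A)`. -/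
def push {Z A A' : C} (a : A ⟶ A') (δ : EExt E Z A) : EExt E Z A' :=
  ((E.obj (op Z)).map a).hom δ

/-- Pull-back of extensions: `c^* δ ∈ 𝔼(Z', A)` for `c : Z' ⟶ Z` and `δ ∈ 𝔼(Z, A)`. -/
def pull {Z Z' A : C} (c : Z' ⟶ Z) (δ : EExt E Z A) : EExt E Z' A :=
  ((E.map c.op).app A).hom δ

end Bifunctor

section Additive

variable {C : Type u} [Category.{v} C] [Preadditive C] [HasZeroObject C] [HasBinaryBiproducts C]

/-- The direct sum `δ ⊕ δ' ∈ 𝔼(Z ⊕ Z', A ⊕ A')`, with components `(δ, 0, 0, δ')`. -/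
noncomputable def extSum (E : Cᵒᵖ ⥤ C ⥤ AddCommGrpCat.{w}) {Z Z' A A' : C}
    (δ : EExt E Z A) (δ' : EExt E Z' A') : EExt E (Z ⊞ Z') (A ⊞ A') :=
  pull E biprod.fst (push E biprod.inl δ) + pull E biprod.snd (push E biprod.inr δ')

end Additive

/-- The structure of an extriangulated category in the sense of Nakaoka and Palu on an additive
category `C`.  The correspondence `𝔰` is encoded by the relation `Realizes δ x y`, meaning
`𝔰(δ) = [A --x--> B --y--> Z]`; `Realizes δ` is exactly one equivalence class of sequences,
where two sequences with the same ends are equivalent if there is an isomorphism of the middle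
terms compatible with the identities of the ends. -/
structure ExtriangulatedStructure (C : Type u) [Category.{v} C] [Preadditive C]
    [HasZeroObject C] [HasBinaryBiproducts C] where
  /-- The bifunctor `𝔼 : Cᵒᵖ × C ⥤ Ab`. -/
  E : Cᵒᵖ ⥤ C ⥤ AddCommGrpCat.{w}
  additive_left : E.Additive
  additive_right : ∀ Z : Cᵒᵖ, (E.obj Z).Additive
  /-- `Realizes δ x y` means `𝔰(δ) = [A --x--> B --y--> Z]`. -/
  Realizes : ∀ {A B Z : C}, EExt E Z A → (A ⟶ B) → (B ⟶ Z) → Prop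
  exists_realizes : ∀ {A Z : C} (δ : EExt E Z A),
    ∃ (B : C) (x : A ⟶ B) (y : B ⟶ Z), Realizes δ x y
  realizes_iff : ∀ {A B B' Z : C} {δ : EExt E Z A} {x : A ⟶ B} {y : B ⟶ Z}
    (x' : A ⟶ B') (y' : B' ⟶ Z), Realizes δ x y →
    (Realizes δ x' y' ↔ ∃ b : B ≅ B', x ≫ b.hom = x' ∧ b.hom ≫ y' = y)
  /-- `𝔰` is a realization: morphisms of extensions lift to morphisms of sequences. -/
  realization : ∀ {A B Z A' B' Z' : C} {δ : EExt E Z A} {δ' : EExt E Z' A'}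
    {x : A ⟶ B} {y : B ⟶ Z} {x' : A' ⟶ B'} {y' : B' ⟶ Z'},
    Realizes δ x y → Realizes δ' x' y' →
    ∀ (a : A ⟶ A') (c : Z ⟶ Z'), push E a δ = pull E c δ' →
      ∃ b : B ⟶ B', x ≫ b = a ≫ x' ∧ y ≫ c = b ≫ y'
  /-- The split extension is realized by the split sequence. -/
  realizes_zero : ∀ A Z : C,
    Realizes (0 : EExt E Z A) (biprod.inl : A ⟶ A ⊞ Z) (biprod.snd : A ⊞ Z ⟶ Z)
  /-- `𝔰` is compatible with direct sums. -/
  realizes_sum : ∀ {A B Z A' B' Z' : C} {δ : EExt E Z A} {δ' : EExt E Z' A'}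
    {x : A ⟶ B} {y : B ⟶ Z} {x' : A' ⟶ B'} {y' : B' ⟶ Z'},
    Realizes δ x y → Realizes δ' x' y' →
    Realizes (extSum E δ δ') (biprod.map x x') (biprod.map y y')
  /-- (ET3) -/
  et3 : ∀ {A B Z A' B' Z' : C} {δ : EExt E Z A} {δ' : EExt E Z' A'}
    {x : A ⟶ B} {y : B ⟶ Z} {x' : A' ⟶ B'} {y' : B' ⟶ Z'},
    Realizes δ x y → Realizes δ' x' y' →
    ∀ (a : A ⟶ A') (b : B ⟶ B'), x ≫ b = a ≫ x' →
      ∃ c : Z ⟶ Z', y ≫ c = b ≫ y' ∧ push E a δ = pull E c δ'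
  /-- (ET3)ᵒᵖ -/
  et3_op : ∀ {A B Z A' B' Z' : C} {δ : EExt E Z A} {δ' : EExt E Z' A'}
    {x : A ⟶ B} {y : B ⟶ Z} {x' : A' ⟶ B'} {y' : B' ⟶ Z'},
    Realizes δ x y → Realizes δ' x' y' →
    ∀ (b : B ⟶ B') (c : Z ⟶ Z'), y ≫ c = b ≫ y' →
      ∃ a : A ⟶ A', x ≫ b = a ≫ x' ∧ push E a δ = pull E c δ'
  /-- (ET4) -/
  et4 : ∀ {A B D K F : C} {δ : EExt E D A} {δ' : EExt E F B}
    {f : A ⟶ B} {f' : B ⟶ D} {g : B ⟶ K} {g' : K ⟶ F},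
    Realizes δ f f' → Realizes δ' g g' →
    ∃ (M : C) (h' : K ⟶ M) (d : D ⟶ M) (e : M ⟶ F) (δ'' : EExt E M A),
      Realizes δ'' (f ≫ g) h' ∧ g ≫ h' = f' ≫ d ∧ h' ≫ e = g' ∧
      Realizes (push E f' δ') d e ∧
      pull E d δ'' = δ ∧
      push E f δ'' = pull E e δ'
  /-- (ET4)ᵒᵖ -/
  et4_op : ∀ {D A B F K : C} {δ : EExt E B D} {δ' : EExt E K F}
    {f' : D ⟶ A} {f : A ⟶ B} {g' : F ⟶ B} {g : B ⟶ K},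
    Realizes δ f' f → Realizes δ' g' g →
    ∃ (M : C) (d : D ⟶ M) (e : M ⟶ F) (h' : M ⟶ A) (δ'' : EExt E K M),
      Realizes δ'' h' (f ≫ g) ∧ d ≫ h' = f' ∧ h' ≫ f = e ≫ g' ∧
      Realizes (pull E g' δ) d e ∧
      push E e δ'' = δ' ∧
      push E d δ = pull E g δ''

namespace ExtriangulatedStructure

variable {C : Type u} [Category.{v} C] [Preadditive C] [HasZeroObject C] [HasBinaryBiproducts C]
  (𝓔 : ExtriangulatedStructure.{w} C)

/-- `A --x--> B --y--> Z` is a conflation, i.e. it underlies an `𝔼`-triangle. -/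
def IsConflation {A B Z : C} (x : A ⟶ B) (y : B ⟶ Z) : Prop :=
  ∃ δ : EExt 𝓔.E Z A, 𝓔.Realizes δ x y

/-- Projective objects: they lift along deflations. -/
def IsProj : ObjectProperty C := fun P =>
  ∀ ⦃A B Z : C⦄ (x : A ⟶ B) (y : B ⟶ Z), 𝓔.IsConflation x y →
    ∀ c : P ⟶ Z, ∃ b : P ⟶ B, b ≫ y = c

/-- Injective objects: they extend along inflations. -/
def IsInj : ObjectProperty C := fun I =>
  ∀ ⦃A B Z : C⦄ (x : A ⟶ B) (y : B ⟶ Z), 𝓔.IsConflation x y →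
    ∀ a : A ⟶ I, ∃ b : B ⟶ I, x ≫ b = a

def EnoughProj : Prop :=
  ∀ Z : C, ∃ (A P : C) (x : A ⟶ P) (y : P ⟶ Z), 𝓔.IsProj P ∧ 𝓔.IsConflation x y

def EnoughInj : Prop :=
  ∀ A : C, ∃ (I Z : C) (x : A ⟶ I) (y : I ⟶ Z), 𝓔.IsInj I ∧ 𝓔.IsConflation x y

/-- `Cone(P, Q)`: the objects `Z` admitting an `𝔼`-triangle `A ⟶ B ⟶ Z ⇢` with `A` in `P` and
`B` in `Q`. -/
def cone (P Q : ObjectProperty C) : ObjectProperty C := fun Z =>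
  ∃ (A B : C) (x : A ⟶ B) (y : B ⟶ Z), P A ∧ Q B ∧ 𝓔.IsConflation x y

/-- The cosyzygy `Σ P` of a full subcategory `P`. -/
def cosyzygy (P : ObjectProperty C) : ObjectProperty C := 𝓔.cone P 𝓔.IsInj

end ExtriangulatedStructure

/-- Full additive subcategories, closed under isomorphisms and direct summands. -/
structure IsSummandClosedAdditive {C : Type u} [Category.{v} C] [Preadditive C]
    [HasZeroObject C] [HasBinaryBiproducts C] (P : ObjectProperty C) : Prop where
  zero : ∃ Z : C, IsZero Z ∧ P Z
  of_iso : ∀ {A B : C}, (A ≅ B) → P A → P B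
  biprod : ∀ {A B : C}, P A → P B → P (A ⊞ B)
  summand : ∀ {A B : C}, P (A ⊞ B) → P A

/-- `(U, V)` is a (complete) cotorsion pair. -/
structure ExtriangulatedStructure.IsCotorsionPair {C : Type u} [Category.{v} C] [Preadditive C]
    [HasZeroObject C] [HasBinaryBiproducts C] (𝓔 : ExtriangulatedStructure.{w} C)
    (U V : ObjectProperty C) :
    Prop where
  left : IsSummandClosedAdditive U
  right : IsSummandClosedAdditive V
  ext_eq_zero : ∀ {A B : C}, U A → V B → ∀ δ : EExt 𝓔.E A B, δ = 0
  exists_left : ∀ Z : C, ∃ (B A : C) (x : B ⟶ A) (y : A ⟶ Z), V B ∧ U A ∧ 𝓔.IsConflation x y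
  exists_right : ∀ Z : C, ∃ (B A : C) (x : Z ⟶ B) (y : B ⟶ A), V B ∧ U A ∧ 𝓔.IsConflation x y

/-! ## Quotients by ideals of morphisms factoring through a subcategory -/

section Quotient

variable {D : Type u} [Category.{v} D] [Preadditive D]

/-- `f` factors through an object of `W`. -/
def FactorsThrough (W : ObjectProperty D) {A B : D} (f : A ⟶ B) : Prop :=
  ∃ (Z : D) (a : A ⟶ Z) (b : Z ⟶ B), W Z ∧ a ≫ b = f

/-- The subgroup `W(A, B)` generated by the morphisms which factor through an object of `W`.
If `W` is closed under finite direct sums it consists of these morphisms,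
see `mem_factorSubgroup_iff`. -/
def factorSubgroup (W : ObjectProperty D) (A B : D) : AddSubgroup (A ⟶ B) :=
  AddSubgroup.closure {f | FactorsThrough W f}

lemma mem_factorSubgroup_iff [HasBinaryBiproducts D] (W : ObjectProperty D)
    (h0 : ∃ Z : D, W Z) (hW : ∀ {A B : D}, W A → W B → W (A ⊞ B)) {A B : D} (f : A ⟶ B) :
    f ∈ factorSubgroup W A B ↔ FactorsThrough W f := by
  refine ⟨fun hf => ?_, fun hf => AddSubgroup.subset_closure hf⟩
  induction hf using AddSubgroup.closure_induction with
  | mem f hf => exact hf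
  | zero =>
    obtain ⟨Z, hZ⟩ := h0
    exact ⟨Z, 0, 0, hZ, by simp⟩
  | add f g _ _ hf hg =>
    obtain ⟨Z, a, b, hZ, rfl⟩ := hf
    obtain ⟨Z', a', b', hZ', rfl⟩ := hg
    exact ⟨Z ⊞ Z', biprod.lift a a', biprod.desc b b', hW hZ hZ', by simp⟩
  | neg f _ hf =>
    obtain ⟨Z, a, b, hZ, rfl⟩ := hf
    exact ⟨Z, -a, b, hZ, by simp⟩

lemma comp_mem_factorSubgroup (W : ObjectProperty D) {A A' B B' : D} (a : A' ⟶ A) (b : B ⟶ B')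
    {f : A ⟶ B} (hf : f ∈ factorSubgroup W A B) : a ≫ f ≫ b ∈ factorSubgroup W A' B' := by
  induction hf using AddSubgroup.closure_induction with
  | mem f hf =>
    obtain ⟨Z, p, q, hZ, rfl⟩ := hf
    exact AddSubgroup.subset_closure ⟨Z, a ≫ p, q ≫ b, hZ, by simp⟩
  | zero => simp
  | add f g _ _ hf hg => simpa using add_mem hf hg
  | neg f _ hf => simpa using hf

/-- Two parallel morphisms are identified if their difference lies in `W(A, B)`. -/
def quotRel (W : ObjectProperty D) : HomRel D :=
  fun A B f g => f - g ∈ factorSubgroup W A B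

instance (W : ObjectProperty D) : Congruence (quotRel W) where
  equivalence :=
    { refl := fun f => by simp [quotRel]
      symm := fun {f g} h => by simpa [quotRel] using neg_mem h
      trans := fun {f g k} h h' => by simpa [quotRel] using add_mem h h' }
  comp_left f _ _ h := by simpa [quotRel] using comp_mem_factorSubgroup W f (𝟙 _) h
  comp_right g h := by simpa [quotRel] using comp_mem_factorSubgroup W (𝟙 _) g h

/-- The quotient category `D/W`. -/
abbrev IdealQuot (W : ObjectProperty D) : Type u := CategoryTheory.Quotient (quotRel W)

instance (W : ObjectProperty D) : Preadditive (IdealQuot W) :=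
  CategoryTheory.Quotient.preadditive (quotRel W) (fun _ _ f₁ f₂ g₁ g₂ hf hg => by
    have : f₁ + g₁ - (f₂ + g₂) = (f₁ - f₂) + (g₁ - g₂) := by abel
    simpa only [quotRel, this] using add_mem hf hg)

/-- For a full subcategory `P` and `W` (in practice `W ⊆ P`), the category `P/W`: the quotient of
the full subcategory `P` by the morphisms factoring through objects of `P` lying in `W`. -/
abbrev SubQuot (P W : ObjectProperty D) : Type u := IdealQuot (W.inverseImage P.ι)

/-- The functor `P/W ⥤ Q/W` induced by an inclusion `P ⊆ Q`. -/
def incl {P Q : ObjectProperty D} (h : P ≤ Q) (W : ObjectProperty D) :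
    SubQuot P W ⥤ SubQuot Q W :=
  CategoryTheory.Quotient.lift _
    (ObjectProperty.ιOfLE h ⋙ CategoryTheory.Quotient.functor (quotRel (W.inverseImage Q.ι)))
    (fun A B f g hfg => by
      refine CategoryTheory.Quotient.sound _ ?_
      have key : ∀ k : A ⟶ B, k ∈ factorSubgroup (W.inverseImage P.ι) A B →
          (ObjectProperty.ιOfLE h).map k ∈ factorSubgroup (W.inverseImage Q.ι)
            ((ObjectProperty.ιOfLE h).obj A) ((ObjectProperty.ιOfLE h).obj B) := by
        intro k hk
        induction hk using AddSubgroup.closure_induction with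
        | mem k hk =>
          obtain ⟨Z, a, b, hZ, rfl⟩ := hk
          exact AddSubgroup.subset_closure ⟨(ObjectProperty.ιOfLE h).obj Z,
            (ObjectProperty.ιOfLE h).map a, (ObjectProperty.ιOfLE h).map b, hZ,
            (Functor.map_comp _ _ _).symm⟩
        | zero => exact zero_mem _
        | add k l _ _ hk hl => exact add_mem hk hl
        | neg k _ hk => exact neg_mem hk
      exact key _ hfg)

end Quotient

/-! ## Recollements of additive categories -/

section Recollement

universe v₁ u₁ v₂ u₂ v₃ u₃

variable {A' : Type u₁} [Category.{v₁} A'] [Preadditive A']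
  {A : Type u₂} [Category.{v₂} A] [Preadditive A]
  {A'' : Type u₃} [Category.{v₃} A''] [Preadditive A'']

/-- `A' --F--> A --G--> A''` is a localization sequence of additive categories, with right
adjoints `Fr` of `F` and `Gr` of `G`. -/
structure IsLocalizationSequence (F : A' ⥤ A) (G : A ⥤ A'') (Fr : A ⥤ A') (Gr : A'' ⥤ A) :
    Prop where
  additive_cat_left : HasFiniteBiproducts A'
  additive_cat_mid : HasFiniteBiproducts A
  additive_cat_right : HasFiniteBiproducts A''
  additive_F : F.Additive
  additive_G : G.Additive
  full_F : F.Full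
  faithful_F : F.Faithful
  adj_F : Nonempty (F ⊣ Fr)
  adj_G : Nonempty (G ⊣ Gr)
  full_Gr : Gr.Full
  faithful_Gr : Gr.Faithful
  image_eq_kernel : ∀ M : A, F.essImage M ↔ IsZero (G.obj M)

/-- `A' --F--> A --G--> A''` is a colocalization sequence of additive categories, with left
adjoints `Fl` of `F` and `Gl` of `G`. -/
structure IsColocalizationSequence (F : A' ⥤ A) (G : A ⥤ A'') (Fl : A ⥤ A') (Gl : A'' ⥤ A) :
    Prop where
  additive_cat_left : HasFiniteBiproducts A'
  additive_cat_mid : HasFiniteBiproducts A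
  additive_cat_right : HasFiniteBiproducts A''
  additive_F : F.Additive
  additive_G : G.Additive
  full_F : F.Full
  faithful_F : F.Faithful
  adj_F : Nonempty (Fl ⊣ F)
  adj_G : Nonempty (Gl ⊣ G)
  full_Gl : Gl.Full
  faithful_Gl : Gl.Faithful
  image_eq_kernel : ∀ M : A, F.essImage M ↔ IsZero (G.obj M)

/-- `F : A' ⥤ A`, `G : A ⥤ A''` together with the left adjoints `Fl`, `Gl` and the right adjoints
`Fr`, `Gr` form a recollement of additive categories. -/
structure IsRecollement (F : A' ⥤ A) (G : A ⥤ A'') (Fl Fr : A ⥤ A') (Gl Gr : A'' ⥤ A) :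
    Prop where
  localization : IsLocalizationSequence F G Fr Gr
  colocalization : IsColocalizationSequence F G Fl Gl

end Recollement

end ExtriCat

open ExtriCat

namespace ExtriCat

open scoped ZeroObject

/-! All adjoints come from approximations. Let `V_M ⟶ U_M ⟶ M` be the conflation given by `(U, V)`.
Modulo `W = U ⊓ V`, the map `U_M ⟶ M` is universal among maps from objects of `U`: lifts exist
because extensions of `U` by `V` vanish, and they are unique because every morphism from `U` to `V`
factors through `W`. The other approximations are universal in the same way. As `T` is closed under
extensions and contains `V` and `Y`, it follows that `V/W` is reflective (by `(U, V)`) and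
coreflective (by `(X, Y)`) in `T/W`, that `(T ⊓ U)/W` is coreflective with coreflector `G`, and that
`Y/W` is reflective with reflector `G'`.

Both kernels are `V`. Indeed `U_M` lies in `W` iff `M` lies in `V`, since `Σ V ⊆ V` makes `V` closed
under cones. Likewise the reflection of `M` in `Y` lies in `W` iff `M` lies in `X`, since `Σ Y ⊆ Y`
makes `X` closed under cocones; and `X ⊓ T = V`.

The remaining adjoints, right of `G` and left of `G'`, are formal (`exists_adjoints_of_isIso`) once
`G'` inverts the coreflections and `G` inverts the reflections: then `(T ⊓ U)/W` and `Y/W` are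
equivalent compatibly with `G` and `G'`, and each functor inherits the adjoint of the other. The two
inversions are `bijective_comp_of_left_approximation` and `bijective_comp_of_right_approximation`.
In each, a pushout or pullback of conflations produces an object that is one end of the given map
plus a summand in `W`, and whose map from or to the other end is an approximation for the other
cotorsion pair. -/

lemma isIso_of_isIso_comp_comp {C : Type u} [Category.{v} C] {A B : C} (f : A ⟶ B) (g : B ⟶ A)
    [IsIso (f ≫ g)] [IsIso (g ≫ f)] : IsIso f := by
  have : Epi f := epi_of_epi g f
  exact ⟨g ≫ inv (f ≫ g), by simp [← Category.assoc], by simp [← cancel_epi f, ← Category.assoc]⟩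

/-! ### Functoriality of extensions -/

section Bifunctor

variable {C : Type u} [Category.{v} C] (E : Cᵒᵖ ⥤ C ⥤ AddCommGrpCat.{w})

lemma push_push {Z A A' A'' : C} (a : A ⟶ A') (a' : A' ⟶ A'') (δ : EExt E Z A) :
    push E a' (push E a δ) = push E (a ≫ a') δ := by
  simp [push]

lemma pull_pull {Z Z' Z'' A : C} (c : Z' ⟶ Z) (c' : Z'' ⟶ Z') (δ : EExt E Z A) :
    pull E c' (pull E c δ) = pull E (c' ≫ c) δ := by
  simp [pull]

lemma push_pull {Z Z' A A' : C} (a : A ⟶ A') (c : Z' ⟶ Z) (δ : EExt E Z A) :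
    push E a (pull E c δ) = pull E c (push E a δ) := by
  simp [push, pull]

@[simp] lemma push_id {Z A : C} (δ : EExt E Z A) : push E (𝟙 A) δ = δ := by
  simp [push]

@[simp] lemma pull_id {Z A : C} (δ : EExt E Z A) : pull E (𝟙 Z) δ = δ := by
  simp [pull]

@[simp] lemma push_zero {Z A A' : C} (a : A ⟶ A') : push E a (0 : EExt E Z A) = 0 :=
  map_zero _

@[simp] lemma pull_zero {Z Z' A : C} (c : Z' ⟶ Z) : pull E c (0 : EExt E Z A) = 0 :=
  map_zero _

lemma push_add {Z A A' : C} (a : A ⟶ A') (δ δ' : EExt E Z A) :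
    push E a (δ + δ') = push E a δ + push E a δ' :=
  map_add _ _ _

lemma pull_add {Z Z' A : C} (c : Z' ⟶ Z) (δ δ' : EExt E Z A) :
    pull E c (δ + δ') = pull E c δ + pull E c δ' :=
  map_add _ _ _

end Bifunctor

/-! ### Exact sequences, pushouts and pullbacks of conflations -/

namespace ExtriangulatedStructure

variable {C : Type u} [Category.{v} C] [Preadditive C] [HasZeroObject C] [HasBinaryBiproducts C]
  (𝓔 : ExtriangulatedStructure.{w} C)

@[simp] lemma zero_push {Z A A' : C} (δ : EExt 𝓔.E Z A) : push 𝓔.E (0 : A ⟶ A') δ = 0 := by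
  have := 𝓔.additive_right (op Z)
  simp [push]

@[simp] lemma zero_pull {Z Z' A : C} (δ : EExt 𝓔.E Z A) : pull 𝓔.E (0 : Z' ⟶ Z) δ = 0 := by
  have := 𝓔.additive_left
  simp [pull]

variable {𝓔} {A B Z K : C} {δ : EExt 𝓔.E Z A} {x : A ⟶ B} {y : B ⟶ Z}

lemma Realizes.push_eq_zero (h : 𝓔.Realizes δ x y) : push 𝓔.E x δ = 0 := by
  obtain ⟨c, -, hc⟩ := 𝓔.et3 h (𝓔.realizes_zero B (0 : C)) x biprod.inl rfl
  simpa using hc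

lemma Realizes.pull_eq_zero (h : 𝓔.Realizes δ x y) : pull 𝓔.E y δ = 0 := by
  obtain ⟨c, -, hc⟩ := 𝓔.et3_op (𝓔.realizes_zero (0 : C) B) h biprod.snd y rfl
  simpa using hc.symm

lemma Realizes.exists_lift_of_pull (h : 𝓔.Realizes δ x y) (c : K ⟶ Z)
    (hc : pull 𝓔.E c δ = 0) : ∃ b : K ⟶ B, b ≫ y = c := by
  obtain ⟨b, -, hb⟩ := 𝓔.realization (𝓔.realizes_zero A K) h (𝟙 A) c (by simp [hc])
  exact ⟨biprod.inr ≫ b, by simp [← hb]⟩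

lemma Realizes.exists_desc_of_push (h : 𝓔.Realizes δ x y) (a : A ⟶ K)
    (ha : push 𝓔.E a δ = 0) : ∃ b : B ⟶ K, x ≫ b = a := by
  obtain ⟨b, hb, -⟩ := 𝓔.realization h (𝓔.realizes_zero K Z) a (𝟙 Z) (by simp [ha])
  exact ⟨b ≫ biprod.fst, by simp [reassoc_of% hb]⟩

lemma Realizes.exists_lift (h : 𝓔.Realizes δ x y) (f : K ⟶ B) (hf : f ≫ y = 0) :
    ∃ g : K ⟶ A, g ≫ x = f := by
  obtain ⟨a, ha, -⟩ := 𝓔.et3_op (𝓔.realizes_zero K (0 : C)) h (biprod.fst ≫ f) 0 (by simp [hf])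
  exact ⟨a, by simpa using ha.symm⟩

lemma Realizes.exists_desc (h : 𝓔.Realizes δ x y) (f : B ⟶ K) (hf : x ≫ f = 0) :
    ∃ g : Z ⟶ K, y ≫ g = f := by
  obtain ⟨c, hc, -⟩ := 𝓔.et3 h (𝓔.realizes_zero (0 : C) K) 0 (f ≫ biprod.inr)
    (by simp [reassoc_of% hf])
  exact ⟨c, by simpa using hc⟩

/-- Since `x_* ε = 0`, the map `x` extends over the middle term of a realization of `ε`; (ET3) then
compares that realization with `δ`. -/
lemma Realizes.exists_eq_pull (h : 𝓔.Realizes δ x y) (ε : EExt 𝓔.E K A)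
    (hε : push 𝓔.E x ε = 0) : ∃ c : K ⟶ Z, ε = pull 𝓔.E c δ := by
  obtain ⟨N, n, k, hn⟩ := 𝓔.exists_realizes ε
  obtain ⟨b, hb⟩ := hn.exists_desc_of_push x hε
  obtain ⟨c, -, hc⟩ := 𝓔.et3 hn h (𝟙 A) b (by simp [hb])
  exact ⟨c, by simpa using hc⟩

lemma Realizes.exists_eq_push (h : 𝓔.Realizes δ x y) (ε : EExt 𝓔.E Z K)
    (hε : pull 𝓔.E y ε = 0) : ∃ a : A ⟶ K, ε = push 𝓔.E a δ := by
  obtain ⟨N, n, k, hn⟩ := 𝓔.exists_realizes ε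
  obtain ⟨b, hb⟩ := hn.exists_lift_of_pull y hε
  obtain ⟨a, -, ha⟩ := 𝓔.et3_op h hn b (𝟙 Z) (by simp [hb])
  exact ⟨a, by simpa using ha.symm⟩

/-- (ET4) yields a conflation `Z ⟶ M ⟶ K` with class `y_* ε = 0`; pulling the composite extension
back along a section of `M ⟶ K` gives `ε'`. -/
lemma Realizes.exists_eq_push_middle (h : 𝓔.Realizes δ x y) (ε : EExt 𝓔.E K B)
    (hε : push 𝓔.E y ε = 0) : ∃ ε' : EExt 𝓔.E K A, ε = push 𝓔.E x ε' := by
  obtain ⟨N, n, k, hn⟩ := 𝓔.exists_realizes ε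
  obtain ⟨M, h', d, e, δ'', -, -, -, hd, -, hp⟩ := 𝓔.et4 h hn
  obtain ⟨s, hs⟩ := hd.exists_lift_of_pull (𝟙 K) (by simp [hε])
  refine ⟨pull 𝓔.E s δ'', ?_⟩
  rw [push_pull, hp, pull_pull, hs, pull_id]

lemma Realizes.exists_eq_pull_middle (h : 𝓔.Realizes δ x y) (ε : EExt 𝓔.E B K)
    (hε : pull 𝓔.E x ε = 0) : ∃ ε' : EExt 𝓔.E Z K, ε = pull 𝓔.E y ε' := by
  obtain ⟨N, n, k, hn⟩ := 𝓔.exists_realizes ε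
  obtain ⟨M, d, e, h', δ'', -, -, -, hd, -, hp⟩ := 𝓔.et4_op hn h
  obtain ⟨s, hs⟩ := hd.exists_desc_of_push (𝟙 K) (by simp [hε])
  refine ⟨push 𝓔.E s δ'', ?_⟩
  rw [← push_pull, ← hp, push_push, hs, push_id]

/-- A realization of the zero extension is a split sequence. -/
lemma Realizes.exists_iso_biprod (h : 𝓔.Realizes δ x y) (hδ : δ = 0) :
    ∃ b : A ⊞ Z ≅ B, biprod.inl ≫ b.hom = x ∧ b.hom ≫ y = biprod.snd := by
  subst hδ
  exact (𝓔.realizes_iff x y (𝓔.realizes_zero A Z)).1 h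

lemma Realizes.exists_splitting (h : 𝓔.Realizes δ x y) (hδ : δ = 0) :
    ∃ (r : B ⟶ A) (s : Z ⟶ B), x ≫ r = 𝟙 A ∧ s ≫ y = 𝟙 Z ∧ r ≫ x + y ≫ s = 𝟙 B := by
  obtain ⟨b, rfl, hb⟩ := h.exists_iso_biprod hδ
  obtain rfl : y = b.inv ≫ biprod.snd := by simp [← hb]
  refine ⟨b.inv ≫ biprod.fst, biprod.inr ≫ b.hom, by simp, by simp, ?_⟩
  have := congr(b.inv ≫ ($(biprod.total (X := A) (Y := Z))) ≫ b.hom)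
  simpa only [Preadditive.add_comp, Preadditive.comp_add, Category.assoc, Category.id_comp,
    Iso.inv_hom_id] using this

lemma IsProj.ext_eq_zero (hK : 𝓔.IsProj K) (ε : EExt 𝓔.E K A) : ε = 0 := by
  obtain ⟨N, n, k, hn⟩ := 𝓔.exists_realizes ε
  obtain ⟨s, hs⟩ := hK n k ⟨ε, hn⟩ (𝟙 K)
  rw [← pull_id 𝓔.E ε, ← hs, ← pull_pull, hn.pull_eq_zero, pull_zero]

lemma IsInj.ext_eq_zero (hK : 𝓔.IsInj K) (ε : EExt 𝓔.E Z K) : ε = 0 := by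
  obtain ⟨N, n, k, hn⟩ := 𝓔.exists_realizes ε
  obtain ⟨s, hs⟩ := hK n k ⟨ε, hn⟩ (𝟙 K)
  rw [← push_id 𝓔.E ε, ← hs, ← push_push, hn.push_eq_zero, push_zero]

/-- The difference `θ - 𝟙` factors through `y` and is killed by `y`, so its square is zero. -/
lemma Realizes.isIso_of_endomorphism (h : 𝓔.Realizes δ x y) (θ : B ⟶ B) (hx : x ≫ θ = x)
    (hy : θ ≫ y = y) : IsIso θ := by
  obtain ⟨g, hg⟩ := h.exists_desc (θ - 𝟙 B) (by simp [hx])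
  have hg' : y ≫ g ≫ y = 0 := by rw [reassoc_of% hg]; simp [hy]
  obtain rfl : θ = 𝟙 B + y ≫ g := by rw [hg]; abel
  exact ⟨𝟙 B - y ≫ g, by simp [reassoc_of% hg'], by simp [reassoc_of% hg']⟩

lemma Realizes.push_iso {A' : C} (h : 𝓔.Realizes δ x y) (a : A ≅ A') :
    𝓔.Realizes (push 𝓔.E a.hom δ) (a.inv ≫ x) y := by
  obtain ⟨N, n, k, hn⟩ := 𝓔.exists_realizes (push 𝓔.E a.hom δ)
  obtain ⟨b, hb₁, hb₂⟩ := 𝓔.realization h hn a.hom (𝟙 Z) (by simp)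
  obtain ⟨b', hb₁', hb₂'⟩ := 𝓔.realization hn h a.inv (𝟙 Z) (by simp [push_push])
  simp only [Category.comp_id] at hb₂ hb₂'
  have := h.isIso_of_endomorphism (b ≫ b') (by simp [reassoc_of% hb₁, hb₁'])
    (by simp [← hb₂, ← hb₂'])
  have := hn.isIso_of_endomorphism (b' ≫ b) (by simp [reassoc_of% hb₁', hb₁])
    (by simp [← hb₂, ← hb₂'])
  have := isIso_of_isIso_comp_comp b b'
  exact (𝓔.realizes_iff _ _ hn).2 ⟨(asIso b).symm, by simp [Iso.eq_inv_comp, ← reassoc_of% hb₁],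
    by simp [hb₂]⟩

lemma Realizes.pull_iso {Z' : C} (h : 𝓔.Realizes δ x y) (c : Z' ≅ Z) :
    𝓔.Realizes (pull 𝓔.E c.hom δ) x (y ≫ c.inv) := by
  obtain ⟨N, n, k, hn⟩ := 𝓔.exists_realizes (pull 𝓔.E c.hom δ)
  obtain ⟨b, hb₁, hb₂⟩ := 𝓔.realization h hn (𝟙 A) c.inv (by simp [pull_pull])
  obtain ⟨b', hb₁', hb₂'⟩ := 𝓔.realization hn h (𝟙 A) c.hom (by simp)
  simp only [Category.id_comp] at hb₁ hb₁'
  have := h.isIso_of_endomorphism (b ≫ b') (by simp [reassoc_of% hb₁, hb₁'])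
    (by simp [← hb₂', ← reassoc_of% hb₂])
  have := hn.isIso_of_endomorphism (b' ≫ b) (by simp [reassoc_of% hb₁', hb₁])
    (by simp [← hb₂, ← reassoc_of% hb₂'])
  have := isIso_of_isIso_comp_comp b b'
  exact (𝓔.realizes_iff _ _ hn).2 ⟨(asIso b).symm, by simp [← hb₁], by simp [hb₂]⟩

/-- The pushout of two conflations with the same first term. -/
lemma Realizes.exists_pushout {B' Z' : C} {δ' : EExt 𝓔.E Z' A} {x' : A ⟶ B'} {y' : B' ⟶ Z'}
    (h : 𝓔.Realizes δ x y) (h' : 𝓔.Realizes δ' x' y') :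
    ∃ (N : C) (i : B ⟶ N) (p' : N ⟶ Z') (i' : B' ⟶ N) (p : N ⟶ Z),
      𝓔.IsConflation i p' ∧ 𝓔.IsConflation i' p ∧ i ≫ p = y ∧ i' ≫ p' = y' := by
  -- `N` realizes the extension of `Z ⊞ Z'` by `A` with components `δ` and `δ'`. Restricting to
  -- either summand recovers `B` or `B'`, and (ET4)ᵒᵖ describes the quotient.
  obtain ⟨N, a, f, hN⟩ := 𝓔.exists_realizes
    (pull 𝓔.E (biprod.fst : Z ⊞ Z' ⟶ Z) δ + pull 𝓔.E (biprod.snd : Z ⊞ Z' ⟶ Z') δ')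
  have swap : 𝓔.Realizes (0 : EExt 𝓔.E Z Z') (biprod.inr : Z' ⟶ Z ⊞ Z') biprod.fst :=
    (𝓔.realizes_iff _ _ (𝓔.realizes_zero Z' Z)).2 ⟨biprod.braiding Z' Z, by ext <;> simp, by simp⟩
  obtain ⟨M, d, e, k, ε, hk, -, hke, hd, -⟩ := 𝓔.et4_op hN (𝓔.realizes_zero Z Z')
  obtain ⟨M', d', e', k', ε', hk', -, hke', hd', -⟩ := 𝓔.et4_op hN swap
  simp only [pull_add, pull_pull, biprod.inl_fst, biprod.inl_snd, biprod.inr_fst, biprod.inr_snd,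
    pull_id, zero_pull, add_zero, zero_add] at hd hd'
  obtain ⟨b, -, hb⟩ := (𝓔.realizes_iff d e h).1 hd
  obtain ⟨b', -, hb'⟩ := (𝓔.realizes_iff d' e' h').1 hd'
  refine ⟨N, b.hom ≫ k, f ≫ biprod.snd, b'.hom ≫ k', f ≫ biprod.fst, ⟨_, hk.push_iso b.symm⟩,
    ⟨_, hk'.push_iso b'.symm⟩, ?_, ?_⟩
  · have := congr(b.hom ≫ $hke ≫ biprod.fst)
    simpa [hb] using this
  · have := congr(b'.hom ≫ $hke' ≫ biprod.snd)
    simpa [hb'] using this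

/-- The pullback of two conflations with the same last term. -/
lemma Realizes.exists_pullback {A' B' : C} {δ' : EExt 𝓔.E Z A'} {x' : A' ⟶ B'} {y' : B' ⟶ Z}
    (h : 𝓔.Realizes δ x y) (h' : 𝓔.Realizes δ' x' y') :
    ∃ (N : C) (i : A' ⟶ N) (p : N ⟶ B) (i' : A ⟶ N) (p' : N ⟶ B'),
      𝓔.IsConflation i p ∧ 𝓔.IsConflation i' p' ∧ i' ≫ p = x ∧ i ≫ p' = x' := by
  -- Dually, `N` realizes the extension of `Z` by `A ⊞ A'` with components `δ` and `δ'`; projecting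
  -- to either summand recovers `B` or `B'`.
  obtain ⟨N, f, a, hN⟩ := 𝓔.exists_realizes
    (push 𝓔.E (biprod.inl : A ⟶ A ⊞ A') δ + push 𝓔.E (biprod.inr : A' ⟶ A ⊞ A') δ')
  have swap : 𝓔.Realizes (0 : EExt 𝓔.E A A') (biprod.inr : A' ⟶ A ⊞ A') biprod.fst :=
    (𝓔.realizes_iff _ _ (𝓔.realizes_zero A' A)).2
      ⟨biprod.braiding A' A, by ext <;> simp, by simp⟩
  obtain ⟨M, k, d, e, ε, hk, hke, -, hd, -⟩ := 𝓔.et4 swap hN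
  obtain ⟨M', k', d', e', ε', hk', hke', -, hd', -⟩ := 𝓔.et4 (𝓔.realizes_zero A A') hN
  simp only [push_add, push_push, biprod.inl_fst, biprod.inl_snd, biprod.inr_fst, biprod.inr_snd,
    push_id, zero_push, add_zero, zero_add] at hd hd'
  obtain ⟨b, hb, -⟩ := (𝓔.realizes_iff d e h).1 hd
  obtain ⟨b', hb', -⟩ := (𝓔.realizes_iff d' e' h').1 hd'
  refine ⟨N, biprod.inr ≫ f, k ≫ b.inv, biprod.inl ≫ f, k' ≫ b'.inv, ⟨_, hk.pull_iso b⟩,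
    ⟨_, hk'.pull_iso b'⟩, ?_, ?_⟩
  · have := congr(biprod.inl ≫ $hke ≫ b.inv)
    simpa [← hb] using this
  · have := congr(biprod.inr ≫ $hke' ≫ b'.inv)
    simpa [← hb'] using this

end ExtriangulatedStructure

/-! ### Cotorsion pairs and morphisms modulo their core -/

section

section

variable {C : Type u} [Category.{v} C] {P : ObjectProperty C} {A B A' B' : C} {f : A ⟶ B}

lemma FactorsThrough.of_source (hA : P A) (f : A ⟶ B) : FactorsThrough P f :=
  ⟨A, 𝟙 A, f, hA, by simp⟩

lemma FactorsThrough.precomp (hf : FactorsThrough P f) (a : A' ⟶ A) : FactorsThrough P (a ≫ f) := by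
  obtain ⟨Z, p, q, hZ, rfl⟩ := hf
  exact ⟨Z, a ≫ p, q, hZ, by simp⟩

lemma FactorsThrough.postcomp (hf : FactorsThrough P f) (b : B ⟶ B') :
    FactorsThrough P (f ≫ b) := by
  obtain ⟨Z, p, q, hZ, rfl⟩ := hf
  exact ⟨Z, p, q ≫ b, hZ, by simp⟩

end

variable {C : Type u} [Category.{v} C] [Preadditive C] [HasZeroObject C] [HasBinaryBiproducts C]

section FactorsThrough

variable {P : ObjectProperty C} {A B : C} {f g : A ⟶ B}

lemma IsSummandClosedAdditive.factorsThrough_add (hP : IsSummandClosedAdditive P)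
    (hf : FactorsThrough P f) (hg : FactorsThrough P g) : FactorsThrough P (f + g) := by
  obtain ⟨Z, a, b, hZ, rfl⟩ := hf
  obtain ⟨Z', a', b', hZ', rfl⟩ := hg
  exact ⟨Z ⊞ Z', biprod.lift a a', biprod.desc b b', hP.biprod hZ hZ', by simp⟩

lemma IsSummandClosedAdditive.factorsThrough_sub_of_eq (hP : IsSummandClosedAdditive P)
    (h : f = g) : FactorsThrough P (f - g) := by
  obtain ⟨Z, -, hZ⟩ := hP.zero
  exact ⟨Z, 0, 0, hZ, by simp [h]⟩

lemma IsSummandClosedAdditive.summand_right (hP : IsSummandClosedAdditive P) (h : P (A ⊞ B)) :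
    P B :=
  hP.summand (hP.of_iso (biprod.braiding A B) h)

lemma IsSummandClosedAdditive.inf {Q : ObjectProperty C} (hP : IsSummandClosedAdditive P)
    (hQ : IsSummandClosedAdditive Q) : IsSummandClosedAdditive (P ⊓ Q) where
  zero := by
    obtain ⟨Z, hZ, hPZ⟩ := hP.zero
    obtain ⟨Z', hZ', hQZ⟩ := hQ.zero
    exact ⟨Z, hZ, hPZ, hQ.of_iso (hZ'.iso hZ) hQZ⟩
  of_iso e h := ⟨hP.of_iso e h.1, hQ.of_iso e h.2⟩
  biprod h h' := ⟨hP.biprod h.1 h'.1, hQ.biprod h.2 h'.2⟩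
  summand h := ⟨hP.summand h.1, hQ.summand h.2⟩

end FactorsThrough

namespace ExtriangulatedStructure

variable {𝓔 : ExtriangulatedStructure.{w} C} {U V : ObjectProperty C} {A B Z K : C}
  {x : A ⟶ B} {y : B ⟶ Z}

namespace IsCotorsionPair

/-- The left approximation of `A` splits, so `A` is a summand of an object of `U`. -/
lemma mem_left (h : 𝓔.IsCotorsionPair U V) (hA : ∀ B, V B → ∀ δ : EExt 𝓔.E A B, δ = 0) : U A := by
  obtain ⟨B, U', x, y, hB, hU, δ, hδ⟩ := h.exists_left A
  obtain ⟨e, -⟩ := hδ.exists_iso_biprod (hA B hB δ)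
  exact h.left.summand_right (h.left.of_iso e.symm hU)

lemma mem_right (h : 𝓔.IsCotorsionPair U V) (hB : ∀ A, U A → ∀ δ : EExt 𝓔.E A B, δ = 0) :
    V B := by
  obtain ⟨V', A, x, y, hV, hA, δ, hδ⟩ := h.exists_right B
  obtain ⟨e, -⟩ := hδ.exists_iso_biprod (hB A hA δ)
  exact h.right.summand (h.right.of_iso e.symm hV)

lemma left_of_retract (h : 𝓔.IsCotorsionPair U V) (s : A ⟶ B) (r : B ⟶ A) (hs : s ≫ r = 𝟙 A)
    (hB : U B) : U A :=
  h.mem_left fun K hK δ => by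
    rw [← pull_id 𝓔.E δ, ← hs, ← pull_pull, h.ext_eq_zero hB hK (pull 𝓔.E r δ), pull_zero]

lemma right_of_retract (h : 𝓔.IsCotorsionPair U V) (s : A ⟶ B) (r : B ⟶ A) (hs : s ≫ r = 𝟙 A)
    (hB : V B) : V A :=
  h.mem_right fun K hK δ => by
    rw [← push_id 𝓔.E δ, ← hs, ← push_push, h.ext_eq_zero hK hB (push 𝓔.E s δ), push_zero]

lemma left_of_extension (h : 𝓔.IsCotorsionPair U V) (hxy : 𝓔.IsConflation x y) (hA : U A)
    (hZ : U Z) : U B :=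
  h.mem_left fun K hK ε => by
    obtain ⟨δ, hδ⟩ := hxy
    obtain ⟨ε', rfl⟩ := hδ.exists_eq_pull_middle ε (h.ext_eq_zero hA hK _)
    rw [h.ext_eq_zero hZ hK ε', pull_zero]

lemma right_of_extension (h : 𝓔.IsCotorsionPair U V) (hxy : 𝓔.IsConflation x y) (hA : V A)
    (hZ : V Z) : V B :=
  h.mem_right fun K hK ε => by
    obtain ⟨δ, hδ⟩ := hxy
    obtain ⟨ε', rfl⟩ := hδ.exists_eq_push_middle ε (h.ext_eq_zero hK hZ _)
    rw [h.ext_eq_zero hK hA ε', push_zero]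

lemma exists_lift (h : 𝓔.IsCotorsionPair U V) (hxy : 𝓔.IsConflation x y) (hA : V A)
    (hK : U K) (f : K ⟶ Z) : ∃ g : K ⟶ B, g ≫ y = f := by
  obtain ⟨δ, hδ⟩ := hxy
  exact hδ.exists_lift_of_pull f (h.ext_eq_zero hK hA _)

lemma exists_desc (h : 𝓔.IsCotorsionPair U V) (hxy : 𝓔.IsConflation x y) (hZ : U Z)
    (hK : V K) (f : A ⟶ K) : ∃ g : B ⟶ K, x ≫ g = f := by
  obtain ⟨δ, hδ⟩ := hxy
  exact hδ.exists_desc_of_push f (h.ext_eq_zero hZ hK _)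

lemma exists_splitting (h : 𝓔.IsCotorsionPair U V) (hxy : 𝓔.IsConflation x y) (hA : V A)
    (hZ : U Z) :
    ∃ (r : B ⟶ A) (s : Z ⟶ B), x ≫ r = 𝟙 A ∧ s ≫ y = 𝟙 Z ∧ r ≫ x + y ≫ s = 𝟙 B := by
  obtain ⟨δ, hδ⟩ := hxy
  exact hδ.exists_splitting (h.ext_eq_zero hZ hA _)

/-- The middle term of the left approximation of `B` is an extension of objects of `V`, hence lies
in the core. This gives the uniqueness of lifts modulo the core. -/
lemma factorsThrough (h : 𝓔.IsCotorsionPair U V) (hA : U A) (hB : V B) (f : A ⟶ B) :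
    FactorsThrough (U ⊓ V) f := by
  obtain ⟨V', U', x, y, hV, hU, hxy⟩ := h.exists_left B
  obtain ⟨g, rfl⟩ := h.exists_lift hxy hV hA f
  exact ⟨U', g, y, ⟨hU, h.right_of_extension hxy hV hB⟩, rfl⟩

lemma right_of_isInj (h : 𝓔.IsCotorsionPair U V) (hA : 𝓔.IsInj A) : V A :=
  h.mem_right fun _ _ δ => hA.ext_eq_zero δ

/-- If `V` is closed under cosyzygies, then `U` is closed under cocones of deflations. -/
lemma left_of_cocone (h : 𝓔.IsCotorsionPair U V) (hI : 𝓔.EnoughInj) (hV : 𝓔.cosyzygy V ≤ V)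
    (hxy : 𝓔.IsConflation x y) (hB : U B) (hZ : U Z) : U A :=
  h.mem_left fun K hK ε => by
    -- Dimension shift: `ε` comes from a map `A ⟶ Q` into the cosyzygy, which extends to `B` because
    -- `Q` lies in `V`.
    obtain ⟨I, Q, i, p, hi, δ, hδ⟩ := hI K
    obtain ⟨c, rfl⟩ := hδ.exists_eq_pull ε (hi.ext_eq_zero _)
    have hQ : V Q := hV _ ⟨K, I, i, p, hK, hi, δ, hδ⟩
    obtain ⟨c', rfl⟩ := h.exists_desc hxy hZ hQ c
    rw [← pull_pull, h.ext_eq_zero hB hK (pull 𝓔.E c' δ), pull_zero]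

/-- If `V` is closed under cosyzygies, then `V` is closed under cones of inflations. -/
lemma right_of_cone (h : 𝓔.IsCotorsionPair U V) (hP : 𝓔.EnoughProj) (hI : 𝓔.EnoughInj)
    (hV : 𝓔.cosyzygy V ≤ V) (hxy : 𝓔.IsConflation x y) (hA : V A) (hB : V B) : V Z :=
  h.mem_right fun K hK ε => by
    -- The dual shift: the syzygy `Q` lies in `U` by `left_of_cocone`, so `Q ⟶ Z` lifts to `B`.
    obtain ⟨Q, P, i, p, hp, δ, hδ⟩ := hP K
    obtain ⟨c, rfl⟩ := hδ.exists_eq_push ε (hp.ext_eq_zero _)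
    have hQ : U Q := h.left_of_cocone hI hV ⟨δ, hδ⟩
      (h.mem_left fun _ _ δ => hp.ext_eq_zero δ) hK
    obtain ⟨c', rfl⟩ := h.exists_lift hxy hA hQ c
    rw [← push_push, h.ext_eq_zero hK hB (push 𝓔.E c' δ), push_zero]

/-- Lift the second factor of `f ≫ y` along `y`. The corrected `f` is killed by `y`, so it passes
through `A`, and a map from `U` to `V` factors through the core. -/
lemma factorsThrough_of_comp_deflation (h : 𝓔.IsCotorsionPair U V) (hxy : 𝓔.IsConflation x y)
    (hA : V A) (hK : U K) (f : K ⟶ B) (hf : FactorsThrough (U ⊓ V) (f ≫ y)) :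
    FactorsThrough (U ⊓ V) f := by
  obtain ⟨W, p, q, hW, hpq⟩ := hf
  obtain ⟨q', rfl⟩ := h.exists_lift hxy hA hW.1 q
  obtain ⟨δ, hδ⟩ := hxy
  obtain ⟨g, hg⟩ := hδ.exists_lift (f - p ≫ q') (by simp [← hpq])
  have := (h.left.inf h.right).factorsThrough_add ((h.factorsThrough hK hA g).postcomp x)
    ⟨W, p, q', hW, rfl⟩
  rwa [hg, sub_add_cancel] at this

lemma factorsThrough_of_inflation_comp (h : 𝓔.IsCotorsionPair U V) (hxy : 𝓔.IsConflation x y)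
    (hZ : U Z) (hK : V K) (f : B ⟶ K) (hf : FactorsThrough (U ⊓ V) (x ≫ f)) :
    FactorsThrough (U ⊓ V) f := by
  obtain ⟨W, p, q, hW, hpq⟩ := hf
  obtain ⟨p', rfl⟩ := h.exists_desc hxy hZ hW.2 p
  obtain ⟨δ, hδ⟩ := hxy
  obtain ⟨g, hg⟩ := hδ.exists_desc (f - p' ≫ q) (by simp [← hpq])
  have := (h.left.inf h.right).factorsThrough_add ((h.factorsThrough hZ hK g).precomp y)
    ⟨W, p', q, hW, rfl⟩
  rwa [hg, sub_add_cancel] at this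

end IsCotorsionPair

/-- Reflections along `(X, Y)` invert the coreflections along `(U, V)`. -/
lemma bijective_comp_of_left_approximation {X Y : ObjectProperty C}
    (hUV : 𝓔.IsCotorsionPair U V) (hXY : 𝓔.IsCotorsionPair X Y)
    (hI : 𝓔.EnoughInj) (hVX : V ≤ X) (hV : 𝓔.cosyzygy V ≤ V)
    (hxy : 𝓔.IsConflation x y) (hA : V A) (hK : Y K) :
    (∀ g : B ⟶ K, ∃ g' : Z ⟶ K, FactorsThrough (X ⊓ Y) (g - y ≫ g')) ∧
      ∀ f : Z ⟶ K, FactorsThrough (X ⊓ Y) (y ≫ f) → FactorsThrough (X ⊓ Y) f := by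
  obtain ⟨I, Q, i, p, hi, hip⟩ := hI A
  have hQ : V Q := hV _ ⟨A, I, i, p, hA, hi, hip⟩
  have hIW : (X ⊓ Y) I :=
    ⟨hVX _ (hUV.right_of_isInj hi), hXY.right_of_isInj hi⟩
  obtain ⟨δ, hδ⟩ := hxy
  -- In the pushout, `I ⟶ N ⟶ Z` splits, so `N` is `Z` plus an object of the core, while `B ⟶ N` has
  -- cone `Q` in `X` and is therefore universal for maps into `Y`.
  obtain ⟨N, a, q, j, z, haq, ⟨ε, hε⟩, haz, -⟩ := hδ.exists_pushout hip.choose_spec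
  obtain ⟨r, s, -, hs, hrs⟩ := hε.exists_splitting (hi.ext_eq_zero _)
  refine ⟨fun g => ?_, fun f hf => ?_⟩
  · obtain ⟨g', rfl⟩ := hXY.exists_desc haq (hVX _ hQ) hK g
    refine ⟨s ≫ g', ?_⟩
    have : a ≫ g' - y ≫ s ≫ g' = (a ≫ r) ≫ j ≫ g' := by
      have := congr(a ≫ $hrs ≫ g')
      simp only [Preadditive.add_comp, Preadditive.comp_add, Category.id_comp, Category.assoc,
        reassoc_of% haz] at this
      simp [← this]
    rw [this]
    exact ⟨I, _, _, hIW, rfl⟩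
  · have := (hXY.factorsThrough_of_inflation_comp haq (hVX _ hQ) hK (z ≫ f)
      (by rwa [reassoc_of% haz])).precomp s
    rwa [reassoc_of% hs] at this

/-- Coreflections along `(U, V)` invert the reflections along `(X, Y)`. -/
lemma bijective_comp_of_right_approximation {S T X Y : ObjectProperty C}
    (hST : 𝓔.IsCotorsionPair S T) (hUV : 𝓔.IsCotorsionPair U V) (hXY : 𝓔.IsCotorsionPair X Y)
    (hW₁ : U ⊓ V = S ⊓ T) (hW₂ : U ⊓ V = X ⊓ Y)
    (hI : 𝓔.EnoughInj) (hXT : X ⊓ T = V) (hY : 𝓔.cosyzygy Y ≤ Y)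
    (hxy : 𝓔.IsConflation x y) (hA : T A) (hB : T B) (hZ : X Z) (hK : U K) :
    (∀ g : K ⟶ B, ∃ g' : K ⟶ A, FactorsThrough (U ⊓ V) (g - g' ≫ x)) ∧
      ∀ f : K ⟶ A, FactorsThrough (U ⊓ V) (f ≫ x) → FactorsThrough (U ⊓ V) f := by
  obtain ⟨T', S', i, p, hT', hS', hip⟩ := hST.exists_left Z
  obtain ⟨δ, hδ⟩ := hxy
  -- In the pullback, `A ⟶ N ⟶ S'` splits, so `N` is `A` plus `S'`; the deflation `N ⟶ B` has cocone
  -- `T'`.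
  obtain ⟨N, a, q, j, z, haq, hjz, hjq, -⟩ := hδ.exists_pullback hip.choose_spec
  obtain ⟨r, s, hr, hs, hrs⟩ := hST.exists_splitting hjz hA hS'
  -- `N` is an extension of `B` by `T'`, so it lies in `T`, and so does its retract `S'`.
  have hSW : (U ⊓ V) S' := by
    rw [hW₁]
    exact ⟨hS', hST.right_of_retract s z hs (hST.right_of_extension haq hT' hB)⟩
  -- As `S'` lies in the core, `T'` is a cocone of a deflation in `X`. Hence `N ⟶ B` is universal
  -- for maps from `U`.
  have hTV : V T' := by
    rw [← hXT]
    exact ⟨hXY.left_of_cocone hI hY hip (hW₂ ▸ hSW).1 hZ, hT'⟩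
  refine ⟨fun g => ?_, fun f hf => ?_⟩
  · obtain ⟨g', rfl⟩ := hUV.exists_lift haq hTV hK g
    refine ⟨g' ≫ r, ?_⟩
    have : g' ≫ q - (g' ≫ r) ≫ x = (g' ≫ z) ≫ s ≫ q := by
      have := congr(g' ≫ $hrs ≫ q)
      simp only [Preadditive.add_comp, Preadditive.comp_add, Category.id_comp, Category.assoc,
        hjq] at this
      simp [← this]
    rw [this]
    exact ⟨S', _, _, hSW, rfl⟩
  · have := (hUV.factorsThrough_of_comp_deflation haq hTV hK (f ≫ j)
      (by rwa [Category.assoc, hjq])).postcomp r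
    rwa [Category.assoc, hr, Category.comp_id] at this

end ExtriangulatedStructure

end

/-! ### Formal criteria for adjoints -/

section Adjoints

universe v₁ u₁ v₂ u₂ v₃ u₃

variable {A : Type u₁} [Category.{v₁} A] {B : Type u₂} [Category.{v₂} B]
  {D : Type u₃} [Category.{v₃} D]

/-- The isomorphism `e` records that the counit is the chosen universal map, so that the conflation
behind it remains available. -/
lemma exists_rightAdjoint (F : A ⥤ B) [F.Full] [F.Faithful] (N : B → A)
    (c : ∀ M, F.obj (N M) ⟶ M)
    (h : ∀ M K, Function.Bijective (fun g : F.obj K ⟶ F.obj (N M) => g ≫ c M)) :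
    ∃ (G : B ⥤ A) (adj : F ⊣ G),
      ∀ M, ∃ e : G.obj M ≅ N M, adj.counit.app M = F.map e.hom ≫ c M := by
  have h' (M K) : Function.Bijective (fun g : K ⟶ N M => F.map g ≫ c M) :=
    (h M K).comp ⟨F.map_injective, F.map_surjective⟩
  refine ⟨_, Adjunction.adjunctionOfEquivRight (F := F) (G_obj := N)
    (fun K M => (Equiv.ofBijective _ (h' M K)).symm) ?_, fun M => ⟨Iso.refl _, ?_⟩⟩
  · intro K' K M f g
    rw [Equiv.symm_apply_eq]
    have := (Equiv.ofBijective _ (h' M K)).apply_symm_apply g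
    simp only [Equiv.ofBijective_apply] at this
    simp [this]
  · simp

lemma exists_leftAdjoint (F : A ⥤ B) [F.Full] [F.Faithful] (N : B → A)
    (c : ∀ M, M ⟶ F.obj (N M))
    (h : ∀ M K, Function.Bijective (fun g : F.obj (N M) ⟶ F.obj K => c M ≫ g)) :
    ∃ (G : B ⥤ A) (adj : G ⊣ F),
      ∀ M, ∃ e : N M ≅ G.obj M, adj.unit.app M = c M ≫ F.map e.hom := by
  have h' (M K) : Function.Bijective (fun g : N M ⟶ K => c M ≫ F.map g) :=
    (h M K).comp ⟨F.map_injective, F.map_surjective⟩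
  refine ⟨_, Adjunction.adjunctionOfEquivLeft (G := F) (F_obj := N)
    (fun M K => (Equiv.ofBijective _ (h' M K))) ?_, fun M => ⟨Iso.refl _, ?_⟩⟩
  · simp
  · simp

/-- By Yoneda: the adjunction turns maps out of `F.map f` into maps from `f` to objects `G.obj K`.
-/
lemma isIso_leftAdjoint_map {F : A ⥤ B} {G : B ⥤ A} (adj : F ⊣ G) {M N : A} (f : M ⟶ N)
    (h : ∀ K, Function.Bijective (fun g : N ⟶ G.obj K => f ≫ g)) : IsIso (F.map f) := by
  rw [isIso_iff_coyoneda_map_bijective]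
  intro K
  have : (fun g : F.obj N ⟶ K => F.map f ≫ g) =
      (adj.homEquiv M K).symm ∘ (fun g => f ≫ g) ∘ adj.homEquiv N K := by
    ext g
    simp [Adjunction.homEquiv_naturality_left_symm]
  rw [this]
  exact (Equiv.bijective _).comp ((h K).comp (Equiv.bijective _))

lemma isIso_rightAdjoint_map {F : A ⥤ B} {G : B ⥤ A} (adj : F ⊣ G) {M N : B} (f : M ⟶ N)
    (h : ∀ K, Function.Bijective (fun g : F.obj K ⟶ M => g ≫ f)) : IsIso (G.map f) := by
  rw [isIso_iff_yoneda_map_bijective]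
  intro K
  have : (fun g : K ⟶ G.obj M => g ≫ G.map f) =
      adj.homEquiv K N ∘ (fun g => g ≫ f) ∘ (adj.homEquiv K M).symm := by
    ext g
    simp [Adjunction.homEquiv_naturality_right]
  rw [this]
  exact (Equiv.bijective _).comp ((h K).comp (Equiv.bijective _))

lemma isIso_map_comp (F : A ⥤ B) {M N K : A} (f : M ⟶ N) (g : N ⟶ K) (hf : IsIso (F.map f))
    (hg : IsIso (F.map g)) : IsIso (F.map (f ≫ g)) := by
  rw [F.map_comp]
  infer_instance

/-- If a coreflective and a reflective subcategory are such that the coreflections are inverted by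
the reflector and the reflections are inverted by the coreflector, then the coreflector has a fully
faithful right adjoint and the reflector has a fully faithful left adjoint. -/
lemma exists_adjoints_of_isIso {i : A ⥤ B} {G : B ⥤ A} {j : D ⥤ B} {G' : B ⥤ D}
    [i.Full] [i.Faithful] [j.Full] [j.Faithful] (adj : i ⊣ G) (adj' : G' ⊣ j)
    (h : ∀ M, IsIso (G'.map (adj.counit.app M))) (h' : ∀ M, IsIso (G.map (adj'.unit.app M))) :
    (∃ Gr : A ⥤ B, Nonempty (G ⊣ Gr) ∧ Gr.Full ∧ Gr.Faithful) ∧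
      ∃ Gl : D ⥤ B, Nonempty (Gl ⊣ G') ∧ Gl.Full ∧ Gl.Faithful := by
  let adjE := adj.comp adj'
  have hu (K) : IsIso (adjE.unit.app K) := by
    have := h' (i.obj K)
    simp only [adjE, Adjunction.comp_unit_app]
    infer_instance
  have hc (K) : IsIso (adjE.counit.app K) := by
    have := h (j.obj K)
    simp only [adjE, Adjunction.comp_counit_app]
    infer_instance
  -- The equivalence has functor `i ⋙ G'` and inverse `j ⋙ G`.
  let e := adjE.toEquivalence
  have h₁ : IsIso (Functor.whiskerRight adj.counit G') :=
    have : ∀ M, IsIso ((Functor.whiskerRight adj.counit G').app M) := h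
    NatIso.isIso_of_isIso_app _
  have h₂ : IsIso (Functor.whiskerRight adj'.unit G) :=
    have : ∀ M, IsIso ((Functor.whiskerRight adj'.unit G).app M) := h'
    NatIso.isIso_of_isIso_app _
  let α : (G ⋙ i) ⋙ G' ≅ 𝟭 B ⋙ G' := asIso (Functor.whiskerRight adj.counit G')
  let β : 𝟭 B ⋙ G ≅ (G' ⋙ j) ⋙ G := asIso (Functor.whiskerRight adj'.unit G)
  -- Up to `e`, the functors `G` and `G'` agree, so `G' ⊣ j` gives a right adjoint of `G` and `i ⊣
  -- G` a left adjoint of `G'`.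
  let γ : G ⋙ e.symm.inverse ≅ G' := α
  let γ' : G' ⋙ e.symm.functor ≅ G := β.symm
  exact ⟨⟨e.functor ⋙ j, ⟨(adj'.comp e.symm.toAdjunction).ofNatIsoLeft γ'⟩,
      inferInstance, inferInstance⟩,
    ⟨e.inverse ⋙ i, ⟨(e.symm.toAdjunction.comp adj).ofNatIsoRight γ⟩,
      inferInstance, inferInstance⟩⟩

end Adjoints

/-! ### Morphisms, zero objects and biproducts in `P/W` -/

namespace SubQuot

variable {C : Type u} [Category.{v} C] [Preadditive C] {P Q W : ObjectProperty C}

/-- The object of `P/W` given by an object of `P`. -/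
abbrev of (W : ObjectProperty C) {A : C} (hA : P A) : SubQuot P W := ⟨⟨A, hA⟩⟩

/-- The morphism of `P/W` given by a morphism between objects of `P`. -/
def homMk {M N : SubQuot P W} (f : M.as.obj ⟶ N.as.obj) : M ⟶ N :=
  (CategoryTheory.Quotient.functor (quotRel (W.inverseImage P.ι))).map (X := M.as) (Y := N.as)
    (ObjectProperty.homMk f)

lemma homMk_surjective {M N : SubQuot P W} (φ : M ⟶ N) : ∃ f, homMk f = φ := by
  obtain ⟨f, rfl⟩ := (CategoryTheory.Quotient.functor (quotRel (W.inverseImage P.ι))).map_surjective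
    (X := M.as) (Y := N.as) φ
  exact ⟨f.hom, rfl⟩

lemma homMk_id (M : SubQuot P W) : homMk (𝟙 M.as.obj) = 𝟙 M := rfl

lemma homMk_zero (M N : SubQuot P W) : homMk (0 : M.as.obj ⟶ N.as.obj) = 0 := rfl

lemma full_incl (h : P ≤ Q) : (incl h W).Full where
  map_surjective {M N} φ := by
    obtain ⟨f, rfl⟩ := homMk_surjective φ
    exact ⟨homMk f, rfl⟩

lemma additive_incl (h : P ≤ Q) : (incl h W).Additive where
  map_add {M N φ ψ} := by
    obtain ⟨f, rfl⟩ := homMk_surjective φ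
    obtain ⟨g, rfl⟩ := homMk_surjective ψ
    rfl

lemma essImage_incl_iff_isZero {D : Type*} [Category* D] (h : P ≤ Q) (G : SubQuot Q W ⥤ D)
    (hG : ∀ M, IsZero (G.obj M) ↔ P M.as.obj) (M : SubQuot Q W) :
    (incl h W).essImage M ↔ IsZero (G.obj M) := by
  refine ⟨fun ⟨N, ⟨e⟩⟩ => ?_, fun hM => ⟨of W ((hG M).1 hM), ⟨Iso.refl _⟩⟩⟩
  exact ((hG _).2 N.as.property).of_iso (G.mapIso e.symm)

variable [HasZeroObject C] [HasBinaryBiproducts C]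

/-- As `W ⊆ P`, factoring through `W` inside `P` is the same as factoring in `C`; equality in `P/W`
thus does not depend on `P`. -/
lemma homMk_eq_iff (hW : IsSummandClosedAdditive W) (hWP : W ≤ P) {M N : SubQuot P W}
    (f g : M.as.obj ⟶ N.as.obj) :
    homMk (M := M) (N := N) f = homMk g ↔ FactorsThrough W (f - g) := by
  refine (CategoryTheory.Quotient.functor_map_eq_iff (quotRel (W.inverseImage P.ι))
    (X := M.as) (Y := N.as) (ObjectProperty.homMk f) (ObjectProperty.homMk g)).trans
    ⟨fun h => ?_, ?_⟩
  · have key (k : M.as ⟶ N.as) (hk : k ∈ factorSubgroup (W.inverseImage P.ι) M.as N.as) :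
        FactorsThrough W k.hom := by
      rw [← mem_factorSubgroup_iff W (hW.zero.imp fun _ h => h.2) hW.biprod]
      induction hk using AddSubgroup.closure_induction with
      | mem k hk =>
        obtain ⟨Z, a, b, hZ, rfl⟩ := hk
        exact AddSubgroup.subset_closure ⟨Z.obj, a.hom, b.hom, hZ, rfl⟩
      | zero => exact zero_mem _
      | add k l _ _ hk hl => exact add_mem hk hl
      | neg k _ hk => exact neg_mem hk
    exact key _ h
  · rintro ⟨Z, a, b, hZ, hab⟩
    exact AddSubgroup.subset_closure ⟨⟨Z, hWP _ hZ⟩, ObjectProperty.homMk a,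
      ObjectProperty.homMk b, hZ, ObjectProperty.hom_ext _ hab⟩

lemma faithful_incl (hW : IsSummandClosedAdditive W) (hWP : W ≤ P) (h : P ≤ Q) :
    (incl h W).Faithful where
  map_injective {M N} φ ψ hφ := by
    obtain ⟨f, rfl⟩ := homMk_surjective φ
    obtain ⟨g, rfl⟩ := homMk_surjective ψ
    rw [homMk_eq_iff hW hWP]
    exact (homMk_eq_iff hW (hWP.trans h) (M := (incl h W).obj M) (N := (incl h W).obj N) f g).1 hφ

lemma isZero_of (hW : IsSummandClosedAdditive W) (hWP : W ≤ P) {M : SubQuot P W}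
    (hM : W M.as.obj) : IsZero M := by
  rw [IsZero.iff_id_eq_zero, ← homMk_id, ← homMk_zero, homMk_eq_iff hW hWP]
  exact FactorsThrough.of_source hM _

/-- If the identity vanishes in the quotient, it factors through an object of `W`, of which `M` is
then a retract. -/
lemma isZero_iff (hW : IsSummandClosedAdditive W) (hWP : W ≤ P)
    (hret : ∀ {A B : C} (s : A ⟶ B) (r : B ⟶ A), s ≫ r = 𝟙 A → W B → W A) (M : SubQuot P W) :
    IsZero M ↔ W M.as.obj := by
  refine ⟨fun h => ?_, isZero_of hW hWP⟩
  rw [IsZero.iff_id_eq_zero, ← homMk_id, ← homMk_zero, homMk_eq_iff hW hWP, sub_zero] at h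
  obtain ⟨Z, s, r, hZ, hsr⟩ := h
  exact hret s r hsr hZ

lemma hasFiniteBiproducts (hW : IsSummandClosedAdditive W) (hWP : W ≤ P)
    (hP : IsSummandClosedAdditive P) : HasFiniteBiproducts (SubQuot P W) := by
  obtain ⟨Z, -, hZ⟩ := hW.zero
  have : HasZeroObject (SubQuot P W) := ⟨of W (hWP _ hZ), isZero_of hW hWP hZ⟩
  have : HasBinaryBiproducts (SubQuot P W) := ⟨fun M N => HasBinaryBiproduct.mk
    { bicone :=
        { pt := of W (hP.biprod M.as.property N.as.property)
          inl := homMk biprod.inl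
          inr := homMk biprod.inr
          fst := homMk biprod.fst
          snd := homMk biprod.snd
          inl_fst := congr_arg homMk (biprod.inl_fst (X := M.as.obj) (Y := N.as.obj))
          inl_snd := congr_arg homMk (biprod.inl_snd (X := M.as.obj) (Y := N.as.obj))
          inr_fst := congr_arg homMk (biprod.inr_fst (X := M.as.obj) (Y := N.as.obj))
          inr_snd := congr_arg homMk (biprod.inr_snd (X := M.as.obj) (Y := N.as.obj)) }
      isBilimit := isBinaryBilimitOfTotal _
        (congr_arg homMk (biprod.total (X := M.as.obj) (Y := N.as.obj))) }⟩
  have := hasFiniteProducts_of_has_binary_and_terminal (C := SubQuot P W)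
  exact HasFiniteBiproducts.of_hasFiniteProducts

lemma bijective_comp_homMk (hW : IsSummandClosedAdditive W) (hWP : W ≤ P) {K M N : SubQuot P W}
    (c : M.as.obj ⟶ N.as.obj)
    (h : ∀ g : K.as.obj ⟶ N.as.obj, ∃ g', FactorsThrough W (g - g' ≫ c))
    (h' : ∀ f : K.as.obj ⟶ M.as.obj, FactorsThrough W (f ≫ c) → FactorsThrough W f) :
    Function.Bijective (fun φ : K ⟶ M => φ ≫ homMk c) := by
  refine ⟨fun φ ψ hφ => ?_, fun φ => ?_⟩
  · obtain ⟨f, rfl⟩ := homMk_surjective φ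
    obtain ⟨g, rfl⟩ := homMk_surjective ψ
    rw [homMk_eq_iff hW hWP]
    refine h' _ ?_
    rw [Preadditive.sub_comp]
    exact (homMk_eq_iff hW hWP _ _).1 hφ
  · obtain ⟨g, rfl⟩ := homMk_surjective φ
    obtain ⟨g', hg'⟩ := h g
    exact ⟨homMk g', ((homMk_eq_iff hW hWP _ _).2 hg').symm⟩

lemma bijective_homMk_comp (hW : IsSummandClosedAdditive W) (hWP : W ≤ P) {K M N : SubQuot P W}
    (c : M.as.obj ⟶ N.as.obj)
    (h : ∀ g : M.as.obj ⟶ K.as.obj, ∃ g', FactorsThrough W (g - c ≫ g'))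
    (h' : ∀ f : N.as.obj ⟶ K.as.obj, FactorsThrough W (c ≫ f) → FactorsThrough W f) :
    Function.Bijective (fun φ : N ⟶ K => homMk c ≫ φ) := by
  refine ⟨fun φ ψ hφ => ?_, fun φ => ?_⟩
  · obtain ⟨f, rfl⟩ := homMk_surjective φ
    obtain ⟨g, rfl⟩ := homMk_surjective ψ
    rw [homMk_eq_iff hW hWP]
    refine h' _ ?_
    rw [Preadditive.comp_sub]
    exact (homMk_eq_iff hW hWP _ _).1 hφ
  · obtain ⟨g, rfl⟩ := homMk_surjective φ
    obtain ⟨g', hg'⟩ := h g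
    exact ⟨homMk g', ((homMk_eq_iff hW hWP _ _).2 hg').symm⟩

end SubQuot

variable {C : Type u} [Category.{v} C] [Preadditive C] [HasZeroObject C] [HasBinaryBiproducts C]

/-! ### Approximations as coreflections and reflections -/

namespace ExtriangulatedStructure.IsCotorsionPair

variable {𝓔 : ExtriangulatedStructure.{w} C} {U V P T : ObjectProperty C}

/-- The middle terms `B` of conflations `A ⟶ B ⟶ M` with `A` in `V` and `B` in `U` provide a right
adjoint of the inclusion `P/(U ⊓ V) ⥤ T/(U ⊓ V)`. -/
lemma exists_coreflector (h : 𝓔.IsCotorsionPair U V) (hPT : P ≤ T) (hPU : P ≤ U)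
    (hWP : U ⊓ V ≤ P)
    (hT : ∀ {A B Z : C} (x : A ⟶ B) (y : B ⟶ Z), 𝓔.IsConflation x y → V A → U B → T Z → P B) :
    ∃ (G : SubQuot T (U ⊓ V) ⥤ SubQuot P (U ⊓ V)) (adj : incl hPT (U ⊓ V) ⊣ G),
      ∀ M, ∃ (A B : C) (x : A ⟶ B) (y : B ⟶ M.as.obj) (hB : P B),
        𝓔.IsConflation x y ∧ V A ∧
        ∃ e : G.obj M ≅ SubQuot.of (U ⊓ V) hB, adj.counit.app M =
          (incl hPT (U ⊓ V)).map e.hom ≫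
            SubQuot.homMk (M := SubQuot.of (U ⊓ V) (hPT _ hB)) (N := M) y := by
  have hW := h.left.inf h.right
  have := SubQuot.full_incl (W := U ⊓ V) hPT
  have := SubQuot.faithful_incl hW hWP hPT
  have key (M : SubQuot T (U ⊓ V)) : ∃ (A B : C) (x : A ⟶ B) (y : B ⟶ M.as.obj),
      𝓔.IsConflation x y ∧ V A ∧ P B := by
    obtain ⟨A, B, x, y, hA, hB, hxy⟩ := h.exists_left M.as.obj
    exact ⟨A, B, x, y, hxy, hA, hT x y hxy hA hB M.as.property⟩
  choose A B x y hxy hA hB using key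
  obtain ⟨G, adj, hG⟩ := exists_rightAdjoint (incl hPT (U ⊓ V))
    (fun M => SubQuot.of (U ⊓ V) (hB M))
    (fun M => SubQuot.homMk (M := SubQuot.of (U ⊓ V) (hPT _ (hB M))) (N := M) (y M))
    (fun M K => SubQuot.bijective_comp_homMk hW (hWP.trans hPT)
      (M := SubQuot.of (U ⊓ V) (hPT _ (hB M))) (y M)
      (fun g => by
        obtain ⟨g', hg'⟩ := h.exists_lift (hxy M) (hA M) (hPU _ K.as.property) g
        exact ⟨g', hW.factorsThrough_sub_of_eq hg'.symm⟩)
      (fun f => h.factorsThrough_of_comp_deflation (hxy M) (hA M) (hPU _ K.as.property) f))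
  exact ⟨G, adj, fun M => ⟨A M, B M, x M, y M, hB M, hxy M, hA M, hG M⟩⟩

/-- The middle terms `B` of conflations `M ⟶ B ⟶ Z` with `Z` in `U` and `B` in `V` provide a left
adjoint of the inclusion `P/(U ⊓ V) ⥤ T/(U ⊓ V)`. -/
lemma exists_reflector (h : 𝓔.IsCotorsionPair U V) (hPT : P ≤ T) (hPV : P ≤ V)
    (hWP : U ⊓ V ≤ P) (hT : ∀ {A B Z : C} (x : A ⟶ B) (y : B ⟶ Z), 𝓔.IsConflation x y → T A →
      V B → U Z → P B) :
    ∃ (G : SubQuot T (U ⊓ V) ⥤ SubQuot P (U ⊓ V)) (adj : G ⊣ incl hPT (U ⊓ V)),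
      ∀ M, ∃ (B Z : C) (x : M.as.obj ⟶ B) (y : B ⟶ Z) (hB : P B),
        𝓔.IsConflation x y ∧ U Z ∧
        ∃ e : SubQuot.of (U ⊓ V) hB ≅ G.obj M, adj.unit.app M =
          SubQuot.homMk (M := M) (N := SubQuot.of (U ⊓ V) (hPT _ hB)) x ≫
            (incl hPT (U ⊓ V)).map e.hom := by
  have hW := h.left.inf h.right
  have := SubQuot.full_incl (W := U ⊓ V) hPT
  have := SubQuot.faithful_incl hW hWP hPT
  have key (M : SubQuot T (U ⊓ V)) : ∃ (B Z : C) (x : M.as.obj ⟶ B) (y : B ⟶ Z),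
      𝓔.IsConflation x y ∧ U Z ∧ P B := by
    obtain ⟨B, Z, x, y, hB, hZ, hxy⟩ := h.exists_right M.as.obj
    exact ⟨B, Z, x, y, hxy, hZ, hT x y hxy M.as.property hB hZ⟩
  choose B Z x y hxy hZ hB using key
  obtain ⟨G, adj, hG⟩ := exists_leftAdjoint (incl hPT (U ⊓ V))
    (fun M => SubQuot.of (U ⊓ V) (hB M))
    (fun M => SubQuot.homMk (M := M) (N := SubQuot.of (U ⊓ V) (hPT _ (hB M))) (x M))
    (fun M K => SubQuot.bijective_homMk_comp hW (hWP.trans hPT)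
      (N := SubQuot.of (U ⊓ V) (hPT _ (hB M))) (x M)
      (fun g => by
        obtain ⟨g', hg'⟩ := h.exists_desc (hxy M) (hZ M) (hPV _ K.as.property) g
        exact ⟨g', hW.factorsThrough_sub_of_eq hg'.symm⟩)
      (fun f => h.factorsThrough_of_inflation_comp (hxy M) (hZ M) (hPV _ K.as.property) f))
  exact ⟨G, adj, fun M => ⟨B M, Z M, x M, y M, hB M, hxy M, hZ M, hG M⟩⟩

end ExtriangulatedStructure.IsCotorsionPair

end ExtriCat

/-! ### The two recollements -/

theorem theorem3p8 {C : Type u} [Category.{v} C] [Preadditive C]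
    [HasZeroObject C] [HasBinaryBiproducts C]
    (𝓔 : ExtriangulatedStructure.{w} C) (hP : 𝓔.EnoughProj) (hI : 𝓔.EnoughInj)
    (S T U V X Y W : ObjectProperty C)
    (hST : 𝓔.IsCotorsionPair S T) (hUV : 𝓔.IsCotorsionPair U V) (hXY : 𝓔.IsCotorsionPair X Y)
    (hW₁ : W = S ⊓ T) (hW₂ : W = U ⊓ V) (hW₃ : W = X ⊓ Y)
    (hV : X ⊓ T = V) (hYT : Y ≤ T)
    (hCosyzV : 𝓔.cosyzygy V ≤ V) (hCosyzY : 𝓔.cosyzygy Y ≤ Y) :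
    ∃ Fl Fr : SubQuot T W ⥤ SubQuot V W,
      (∃ (G : SubQuot T W ⥤ SubQuot (T ⊓ U) W) (Gr : SubQuot (T ⊓ U) W ⥤ SubQuot T W),
        IsRecollement (incl (hV ▸ inf_le_right : V ≤ T) W) G Fl Fr
          (incl (inf_le_left : T ⊓ U ≤ T) W) Gr) ∧
      (∃ (G' : SubQuot T W ⥤ SubQuot Y W) (Gl' : SubQuot Y W ⥤ SubQuot T W),
        IsRecollement (incl (hV ▸ inf_le_right : V ≤ T) W) G' Fl Fr
          Gl' (incl hYT W)) := by
  have hVT : V ≤ T := hV ▸ inf_le_right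
  have hVX : V ≤ X := hV ▸ inf_le_left
  have hWa : IsSummandClosedAdditive W := hW₂ ▸ hUV.left.inf hUV.right
  have hWV : W ≤ V := hW₂ ▸ inf_le_right
  have hWU : W ≤ U := hW₂ ▸ inf_le_left
  have hWY : W ≤ Y := hW₃ ▸ inf_le_right
  have hWT : W ≤ T := hWV.trans hVT
  have hWTU : W ≤ T ⊓ U := le_inf hWT hWU
  have hret {A B : C} (s : A ⟶ B) (r : B ⟶ A) (hsr : s ≫ r = 𝟙 A) (hB : W B) : W A := by
    subst hW₂
    exact ⟨hUV.left_of_retract s r hsr hB.1, hUV.right_of_retract s r hsr hB.2⟩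
  -- The middle term of the left `(X, Y)`-approximation lies in `T`, as an extension of objects of
  -- `T`, and hence in `X ⊓ T = V`.
  obtain ⟨Fr, adjFr, -⟩ : ∃ (Fr : SubQuot T W ⥤ SubQuot V W) (_ : incl hVT W ⊣ Fr), True := by
    obtain ⟨G, adj, -⟩ := hXY.exists_coreflector (P := V) (T := T) hVT hVX (hW₃ ▸ hWV)
      (fun x y hxy hA hB hZ => hV ▸ ⟨hB, hST.right_of_extension hxy (hYT _ hA) hZ⟩)
    subst hW₃
    exact ⟨G, adj, trivial⟩
  obtain ⟨Fl, adjFl, -⟩ : ∃ (Fl : SubQuot T W ⥤ SubQuot V W) (_ : Fl ⊣ incl hVT W), True := by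
    obtain ⟨G, adj, -⟩ := hUV.exists_reflector (P := V) (T := T) hVT le_rfl (hW₂ ▸ hWV)
      (fun x y hxy hA hB hZ => hB)
    subst hW₂
    exact ⟨G, adj, trivial⟩
  have hG := hUV.exists_coreflector (P := T ⊓ U) (T := T) inf_le_left inf_le_right (hW₂ ▸ hWTU)
      (fun x y hxy hA hB hZ => ⟨hST.right_of_extension hxy (hVT _ hA) hZ, hB⟩)
  rw [← hW₂] at hG
  obtain ⟨G, adj, hG⟩ := hG
  have hG' := hXY.exists_reflector (P := Y) (T := T) hYT le_rfl (hW₃ ▸ hWY)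
      (fun x y hxy hA hB hZ => hB)
  rw [← hW₃] at hG'
  obtain ⟨G', adj', hG'⟩ := hG'
  -- The kernel is `V` on the level of objects, because `W` is closed under retracts and `V` under
  -- cones.
  have kerG (M) : IsZero (G.obj M) ↔ V M.as.obj := by
    obtain ⟨A, B, x, y, hB, hxy, hA, e, -⟩ := hG M
    rw [e.isZero_iff, SubQuot.isZero_iff hWa hWTU hret]
    refine ⟨fun h => hUV.right_of_cone hP hI hCosyzV hxy hA (hWV _ h), fun h => ?_⟩
    rw [hW₂]
    exact ⟨hB.2, hUV.right_of_extension hxy hA h⟩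
  have kerG' (M) : IsZero (G'.obj M) ↔ V M.as.obj := by
    obtain ⟨B, Z, x, y, hB, hxy, hZ, e, -⟩ := hG' M
    rw [← e.isZero_iff, SubQuot.isZero_iff hWa hWY hret]
    refine ⟨fun h => hV ▸ ⟨hXY.left_of_cocone hI hCosyzY hxy (hW₃ ▸ h).1 hZ, M.as.property⟩,
      fun h => ?_⟩
    rw [hW₃]
    exact ⟨hXY.left_of_extension hxy (hVX _ h) hZ, hB⟩
  have hi := SubQuot.full_incl (W := W) (inf_le_left : T ⊓ U ≤ T)
  have hi' := SubQuot.faithful_incl hWa hWTU inf_le_left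
  have hj := SubQuot.full_incl (W := W) hYT
  have hj' := SubQuot.faithful_incl hWa hWY hYT
  obtain ⟨⟨Gr, ⟨adjGr⟩, hGr, hGr'⟩, Gl', ⟨adjGl'⟩, hGl', hGl''⟩ :=
    exists_adjoints_of_isIso adj adj'
    (fun M => by
      obtain ⟨A, B, x, y, hB, hxy, hA, e, he⟩ := hG M
      have := isIso_leftAdjoint_map adj'
        (SubQuot.homMk (M := SubQuot.of W hB.1) (N := M) y) (fun K => by
          obtain ⟨h₁, h₂⟩ := ExtriangulatedStructure.bijective_comp_of_left_approximation hUV hXY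
            hI hVX hCosyzV hxy hA K.as.property
          rw [← hW₃] at h₁ h₂
          exact SubQuot.bijective_homMk_comp hWa hWT (M := SubQuot.of W hB.1) y h₁ h₂)
      rw [he]
      exact isIso_map_comp G' _ _ ((incl inf_le_left W ⋙ G').map_isIso e.hom) this)
    (fun M => by
      obtain ⟨B, Z, x, y, hB, hxy, hZ, e, he⟩ := hG' M
      have := isIso_rightAdjoint_map adj
        (SubQuot.homMk (M := M) (N := SubQuot.of W (hYT _ hB)) x) (fun K => by
          obtain ⟨h₁, h₂⟩ := ExtriangulatedStructure.bijective_comp_of_right_approximation hST hUV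
            hXY (hW₂ ▸ hW₁) (hW₂ ▸ hW₃) hI hV hCosyzY hxy M.as.property (hYT _ hB) hZ
            K.as.property.2
          rw [← hW₂] at h₁ h₂
          exact SubQuot.bijective_comp_homMk hWa hWT (N := SubQuot.of W (hYT _ hB)) x h₁ h₂)
      rw [he]
      exact isIso_map_comp G _ _ this ((incl hYT W ⋙ G).map_isIso e.hom))
  have hF := SubQuot.full_incl (W := W) hVT
  have hF' := SubQuot.faithful_incl hWa hWV hVT
  have addF := SubQuot.additive_incl (W := W) hVT
  have addi := SubQuot.additive_incl (W := W) (inf_le_left : T ⊓ U ≤ T)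
  have addj := SubQuot.additive_incl (W := W) hYT
  have addG := adj.right_adjoint_additive
  have addG' := adj'.left_adjoint_additive
  have catV := SubQuot.hasFiniteBiproducts hWa hWV hUV.right
  have catT := SubQuot.hasFiniteBiproducts hWa hWT hST.right
  have catTU := SubQuot.hasFiniteBiproducts hWa hWTU (hST.right.inf hUV.left)
  have catY := SubQuot.hasFiniteBiproducts hWa hWY hXY.right
  have ker := SubQuot.essImage_incl_iff_isZero hVT G kerG
  have ker' := SubQuot.essImage_incl_iff_isZero hVT G' kerG'
  exact ⟨Fl, Fr,
    ⟨G, Gr, ⟨catV, catT, catTU, addF, addG, hF, hF', ⟨adjFr⟩, ⟨adjGr⟩, hGr, hGr', ker⟩,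
      ⟨catV, catT, catTU, addF, addG, hF, hF', ⟨adjFl⟩, ⟨adj⟩, hi, hi', ker⟩⟩,
    ⟨G', Gl', ⟨catV, catT, catY, addF, addG', hF, hF', ⟨adjFr⟩, ⟨adj'⟩, hj, hj', ker'⟩,
      ⟨catV, catT, catY, addF, addG', hF, hF', ⟨adjFl⟩, ⟨adjGl'⟩, hGl', hGl'', ker'⟩⟩⟩
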